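/- Let $K$ be a field of characteristic zero, let $n\ge 3$ be an integer, and put $a=\frac{(n-1)n}{2}$, $q=2\lfloor\frac{n+1}{2}\rfloor-1$, $s_0=a(n-1)+2$. Let $S=\langle a,a+1,a+2\rangle\subseteq\mathbb N$ be the numerical semigroup (containing $0$) generated by $a,a+1,a+2$. Let $\rho:K[[x,y,z]]\to K[[t]]$ be the $K$-algebra homomorphism with $\rho(x)=t^a(1+t^q)$, $\rho(y)=t^{a+1}$, $\rho(z)=t^{a+2}$, and let $\sigma$ be the $K$-algebra endomorphism of $K[[x,y,z]]$ with $\sigma(x)=x^a$, $\sigma(y)=y^{a+1}$, $\sigma(z)=z^{a+2}$. For $f=\sum_\alpha\lambda_\alpha x^{\alpha_1}y^{\alpha_2}z^{\alpha_3}\ne 0$ let $\operatorname{ord}_\sigma(f)$, the $\sigma$-order of $f$, be the order of the power series $\sigma(f)$, and let the $\sigma$-leading form of $f$ be $f^\sigma=\sum\lambda_\alpha x^{\alpha_1}y^{\alpha_2}z^{\alpha_3}$, the sum over all $\alpha\in\mathbb N^3$ with $\alpha_1a+\alpha_2(a+1)+\alpha_3(a+2)=\operatorname{ord}_\sigma(f)$.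 For $r\in S$ put $$W_r=\{g\ne 0\mid g=g^\sigma,\ \operatorname{ord}_\sigma(g)=r\}\cup\{0\},\qquad V_r=\{g\in W_r\mid g\neq 0,\ g=f^\sigma\text{ for some nonzero }f\in\ker\rho\}\cup\{0\};$$ these are $K$-vector spaces. Put $\phi_{r,1}=\ell-\lfloor\frac{\varepsilon+1}{2}\rfloor$, where $r=a\ell+\varepsilon$ with $0\le\varepsilon<a$. An integer $k\in[0,\phi_{r,1}]$ is called $r$-good if $r+kq\ne s+jq$ for all $s\in S$ with $s>r$ and all integers $0\le j\le\phi_{s,1}$; let $G_r$ be the set of $r$-good integers. Let $T_r$ be the span of the monomials $t^{r+kq}$, $0\le k\le\phi_{r,1}$, and $T_r^{G_r}$ the span of those with $k\in G_r$. Then $\rho(W_r)\subseteq T_r$; let $\rho_r^{G_r}:W_r\to T_r^{G_r}$ be the restriction of $\rho$ to $W_r$ followed by the natural projection $T_r\to T_r^{G_r}$. **Theorem.** For every $r\in S$ with $r\ne 0$ and $r<s_0$ one has $V_r=\ker(\rho_r^{G_r})=0$. In particular $\ker\rho$ has nonzero elements and $\min\{\operatorname{ord}_\sigma(f)\mid f\in\ker\rho,\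 f\ne 0\}\ge s_0$, that is, every nonzero $f\in\ker\rho$ has $\sigma$-order at least $s_0$. -/

import Mathlib

noncomputable section

namespace MohPrimes

open MvPowerSeries

/-- The integer `a = (n - 1) n / 2`. -/
def a (n : ℕ) : ℕ := (n - 1) * n / 2

/-- The integer `q = 2 ⌊(n + 1) / 2⌋ - 1`. -/
def q (n : ℕ) : ℕ := 2 * ((n + 1) / 2) - 1

/-- The integer `s₀ = a (n - 1) + 2`. -/
def s0 (n : ℕ) : ℕ := a n * (n - 1) + 2

/-- The numerical semigroup `S = ⟨a, a + 1, a + 2⟩`, zero included. -/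
def S (n : ℕ) : AddSubmonoid ℕ := AddSubmonoid.closure {a n, a n + 1, a n + 2}

/-- The weights `a, a + 1, a + 2` of the variables `x = X 0`, `y = X 1`, `z = X 2`. -/
def wt (n : ℕ) : Fin 3 → ℕ := ![a n, a n + 1, a n + 2]

theorem a_pos {n : ℕ} (hn : 3 ≤ n) : 0 < a n := by
  have h : 2 * 3 ≤ (n - 1) * n := Nat.mul_le_mul (by omega) hn
  unfold a
  omega

theorem wt_pos {n : ℕ} (hn : 3 ≤ n) (i : Fin 3) : 0 < wt n i := by
  have := a_pos hn
  fin_cases i <;> simp [wt, this]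

variable (K : Type*) [Field K]

/-- The images `t^a (1 + t^q)`, `t^(a+1)`, `t^(a+2)` of `x`, `y`, `z` under `ρ`. -/
def rhoImage (n : ℕ) : Fin 3 → PowerSeries K :=
  ![PowerSeries.X ^ a n * (1 + PowerSeries.X ^ q n), PowerSeries.X ^ (a n + 1),
    PowerSeries.X ^ (a n + 2)]

theorem hasSubst_rho {n : ℕ} (hn : 3 ≤ n) :
    HasSubst (S := K) (τ := Unit) (rhoImage K n) := by
  refine hasSubst_of_constantCoeff_zero fun i => ?_
  have h := (a_pos hn).ne'
  change PowerSeries.constantCoeff (rhoImage K n i) = 0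
  fin_cases i <;> simp [rhoImage, h]

theorem hasSubst_sigma {n : ℕ} (hn : 3 ≤ n) :
    HasSubst (fun i : Fin 3 => (X i ^ wt n i : MvPowerSeries (Fin 3) K)) := by
  refine hasSubst_of_constantCoeff_zero fun i => ?_
  simp [(wt_pos hn i).ne']

/-- The `K`-algebra homomorphism `ρ : K⟦x, y, z⟧ → K⟦t⟧` with `ρ(x) = t^a (1 + t^q)`,
`ρ(y) = t^(a+1)`, `ρ(z) = t^(a+2)`, that is, substitution of these power series. -/
def rho {n : ℕ} (hn : 3 ≤ n) : MvPowerSeries (Fin 3) K →ₐ[K] PowerSeries K :=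
  substAlgHom (hasSubst_rho K hn)

/-- The `K`-algebra homomorphism `σ` of `K⟦x, y, z⟧` with `σ(x) = x^a`, `σ(y) = y^(a+1)`,
`σ(z) = z^(a+2)`. -/
def sigma {n : ℕ} (hn : 3 ≤ n) : MvPowerSeries (Fin 3) K →ₐ[K] MvPowerSeries (Fin 3) K :=
  substAlgHom (hasSubst_sigma K hn)

variable {K}

/-- The `σ`-order of `f`, the order of `σ(f)`; it is `⊤` exactly for `f = 0`. -/
def sigmaOrder {n : ℕ} (hn : 3 ≤ n) (f : MvPowerSeries (Fin 3) K) : ℕ∞ :=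
  (sigma K hn f).order

/-- The `σ`-leading form of `f`: the sum of the terms `λ_α x^α₁ y^α₂ z^α₃` of `f` with
`α₁ a + α₂ (a + 1) + α₃ (a + 2) = r`, where `r` is the `σ`-order of `f`. -/
def sigmaLeadingForm {n : ℕ} (hn : 3 ≤ n) (f : MvPowerSeries (Fin 3) K) :
    MvPowerSeries (Fin 3) K :=
  weightedHomogeneousComponent (wt n) (sigmaOrder hn f).toNat f

/-- The exponent of the monomial `σ(m^d)`. -/
def scaleExp (n : ℕ) (d : Fin 3 →₀ ℕ) : Fin 3 →₀ ℕ :=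
  Finsupp.equivFunOnFinite.symm fun i => wt n i * d i

theorem scaleExp_injective {n : ℕ} (hn : 3 ≤ n) : Function.Injective (scaleExp n) := by
  intro d e h
  ext i
  have := DFunLike.congr_fun h i
  exact Nat.eq_of_mul_eq_mul_left (wt_pos hn i) (by simpa [scaleExp] using this)

theorem degree_scaleExp (n : ℕ) (d : Fin 3 →₀ ℕ) :
    (scaleExp n d).degree = Finsupp.weight (wt n) d := by
  rw [Finsupp.degree_eq_sum, Finsupp.weight_apply, Finsupp.sum_fintype _ _ (by simp)]
  simp [scaleExp, mul_comm]

theorem coeff_sigma {n : ℕ} (hn : 3 ≤ n) (f : MvPowerSeries (Fin 3) K) (e : Fin 3 →₀ ℕ) :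
    coeff e (sigma K hn f) = ∑ᶠ d, if e = scaleExp n d then coeff d f else 0 := by
  classical
  rw [sigma, substAlgHom_apply, coeff_subst (hasSubst_sigma K hn)]
  refine finsum_congr fun d => ?_
  have : (d.prod fun s k => (X s ^ wt n s : MvPowerSeries (Fin 3) K) ^ k)
      = monomial (scaleExp n d) 1 := by
    rw [monomial_one_eq, Finsupp.prod_fintype _ _ (by simp), Finsupp.prod_fintype _ _ (by simp)]
    simp [scaleExp, pow_mul]
  rw [this, coeff_monomial]
  split_ifs <;> simp

theorem coeff_scaleExp_sigma {n : ℕ} (hn : 3 ≤ n) (f : MvPowerSeries (Fin 3) K)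
    (d : Fin 3 →₀ ℕ) : coeff (scaleExp n d) (sigma K hn f) = coeff d f := by
  rw [coeff_sigma, finsum_eq_single _ d]
  · simp
  · intro e he
    rw [if_neg fun h => he (scaleExp_injective hn h).symm]

theorem exists_of_coeff_sigma_ne_zero {n : ℕ} (hn : 3 ≤ n) (f : MvPowerSeries (Fin 3) K)
    (e : Fin 3 →₀ ℕ) (h : coeff e (sigma K hn f) ≠ 0) : ∃ d, e = scaleExp n d := by
  by_contra! hc
  exact h (by rw [coeff_sigma]; simp [hc])

theorem sigmaOrder_eq_weightedOrder {n : ℕ} (hn : 3 ≤ n) (f : MvPowerSeries (Fin 3) K) :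
    sigmaOrder hn f = f.weightedOrder (wt n) := by
  apply le_antisymm
  · refine le_weightedOrder _ fun d hd => ?_
    rw [← coeff_scaleExp_sigma hn]
    exact coeff_of_lt_order (by rw [degree_scaleExp]; exact hd)
  · refine le_order fun e he => ?_
    by_contra h
    obtain ⟨d, rfl⟩ := exists_of_coeff_sigma_ne_zero hn f e h
    rw [coeff_scaleExp_sigma] at h
    exact h (coeff_eq_zero_of_lt_weightedOrder _ (by rw [← degree_scaleExp]; exact he))

/-- `σ` is injective. -/
theorem sigma_injective {n : ℕ} (hn : 3 ≤ n) : Function.Injective (sigma K hn) := by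
  intro f g h
  ext d
  rw [← coeff_scaleExp_sigma hn, h, coeff_scaleExp_sigma]

/-- The `σ`-leading form is the preimage under `σ` of the leading form of `σ(f)`. -/
theorem sigma_sigmaLeadingForm {n : ℕ} (hn : 3 ≤ n) (f : MvPowerSeries (Fin 3) K) :
    sigma K hn (sigmaLeadingForm hn f) =
      homogeneousComponent (sigma K hn f).order.toNat (sigma K hn f) := by
  classical
  ext e
  rw [coeff_homogeneousComponent]
  by_cases h : ∃ d, e = scaleExp n d
  · obtain ⟨d, rfl⟩ := h
    rw [coeff_scaleExp_sigma, coeff_scaleExp_sigma, sigmaLeadingForm,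
      coeff_weightedHomogeneousComponent, degree_scaleExp, sigmaOrder]
  · have h0 : ∀ f : MvPowerSeries (Fin 3) K, coeff e (sigma K hn f) = 0 := fun f => by
      by_contra hc
      exact h (exists_of_coeff_sigma_ne_zero hn f e hc)
    simp [h0]

theorem weightedHomogeneous_iff {n : ℕ} (hn : 3 ≤ n) (r : ℕ) (g : MvPowerSeries (Fin 3) K) :
    (g = 0 ∨ g = sigmaLeadingForm hn g ∧ sigmaOrder hn g = r) ↔
      g.IsWeightedHomogeneous (wt n) r := by
  constructor
  · rintro (rfl | ⟨h1, h2⟩)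
    · intro d hd
      simp at hd
    · rw [h1, sigmaLeadingForm, h2]
      exact isWeightedHomogeneous_weightedHomogeneousComponent _ _ _
  · intro h
    by_cases hg : g = 0
    · exact Or.inl hg
    · refine Or.inr ?_
      have h2 : sigmaOrder hn g = r := by
        rw [sigmaOrder_eq_weightedOrder, weightedOrder_eq_nat]
        obtain ⟨d, hd⟩ := (ne_zero_iff_exists_coeff_ne_zero _).1 hg
        refine ⟨⟨d, hd, h hd⟩, fun e he => ?_⟩
        by_contra hc
        exact he.ne (h hc)
      refine ⟨?_, h2⟩
      rw [sigmaLeadingForm, h2]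
      exact isWeightedHomogeneous_iff_eq_weightedHomogeneousComponent.1 h

variable (K)

/-- The space `W_r` of the `σ`-homogeneous power series of `σ`-order `r`, together with `0`. -/
def W {n : ℕ} (hn : 3 ≤ n) (r : ℕ) : Submodule K (MvPowerSeries (Fin 3) K) where
  carrier := {g | g = 0 ∨ g = sigmaLeadingForm hn g ∧ sigmaOrder hn g = r}
  zero_mem' := Or.inl rfl
  add_mem' {f g} hf hg := by
    rw [Set.mem_ofPred_eq, weightedHomogeneous_iff] at *
    exact hf.add hg
  smul_mem' c f hf := by
    rw [Set.mem_ofPred_eq, weightedHomogeneous_iff] at *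
    intro d hd
    refine hf (d := d) fun h0 => hd ?_
    simp [h0]

variable {K} in
theorem mem_W_iff {n : ℕ} (hn : 3 ≤ n) (r : ℕ) (g : MvPowerSeries (Fin 3) K) :
    g ∈ W K hn r ↔ g.IsWeightedHomogeneous (wt n) r :=
  weightedHomogeneous_iff hn r g

variable {K} in
theorem isLeadingForm_iff {n : ℕ} (hn : 3 ≤ n) (r : ℕ) (g : W K hn r) :
    (g = 0 ∨ ∃ f ∈ RingHom.ker (rho K hn), f ≠ 0 ∧ (g : MvPowerSeries (Fin 3) K) =
        sigmaLeadingForm hn f) ↔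
      ∃ f ∈ RingHom.ker (rho K hn), (r : ℕ∞) ≤ f.weightedOrder (wt n) ∧
        (g : MvPowerSeries (Fin 3) K) = weightedHomogeneousComponent (wt n) r f := by
  constructor
  · rintro (rfl | ⟨f, hf, hf0, hg⟩)
    · exact ⟨0, by simp, by simp, by simp⟩
    · have hfin := (ne_zero_iff_weightedOrder_finite (wt n)).1 hf0
      obtain ⟨⟨d, hd, hdw⟩, -⟩ := (weightedOrder_eq_nat _).1 hfin.symm
      have hc : coeff d (g : MvPowerSeries (Fin 3) K) ≠ 0 := by
        classical
        rw [hg, sigmaLeadingForm, sigmaOrder_eq_weightedOrder, coeff_weightedHomogeneousComponent,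
          if_pos hdw]
        exact hd
      have hr : (f.weightedOrder (wt n)).toNat = r :=
        hdw.symm.trans ((mem_W_iff hn r _).1 g.2 hc)
      refine ⟨f, hf, ?_, ?_⟩
      · rw [← hr, hfin]
      · rw [hg, sigmaLeadingForm, sigmaOrder_eq_weightedOrder, hr]
  · rintro ⟨f, hf, hr, hg⟩
    by_cases hg0 : g = 0
    · exact Or.inl hg0
    · have hg1 : (g : MvPowerSeries (Fin 3) K) ≠ 0 := fun h => hg0 (Subtype.ext h)
      refine Or.inr ⟨f, hf, ?_, ?_⟩
      · rintro rfl
        exact hg1 (by simpa using hg)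
      · have : f.weightedOrder (wt n) = r := by
          refine le_antisymm ?_ hr
          by_contra! hlt
          exact hg1 (hg.trans (weightedHomogeneousComponent_of_lt_weightedOrder_eq_zero hlt))
        rw [sigmaLeadingForm, sigmaOrder_eq_weightedOrder, this]
        exact hg

/-- The space `V_r`, as a subspace of `W_r`: the `σ`-leading forms in `W_r` of the nonzero elements
of `ker ρ`, together with `0`. -/
def V {n : ℕ} (hn : 3 ≤ n) (r : ℕ) : Submodule K (W K hn r) where
  carrier := {g | g = 0 ∨ ∃ f ∈ RingHom.ker (rho K hn), f ≠ 0 ∧ g = sigmaLeadingForm hn f}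
  zero_mem' := Or.inl rfl
  add_mem' {g g'} hg hg' := by
    rw [Set.mem_ofPred_eq, isLeadingForm_iff] at *
    obtain ⟨f, hf, hr, h⟩ := hg
    obtain ⟨f', hf', hr', h'⟩ := hg'
    exact ⟨f + f', add_mem hf hf', (le_min hr hr').trans (min_weightedOrder_le_add _),
      by rw [map_add, ← h, ← h', Submodule.coe_add]⟩
  smul_mem' c g hg := by
    rw [Set.mem_ofPred_eq, isLeadingForm_iff] at *
    obtain ⟨f, hf, hr, h⟩ := hg
    refine ⟨c • f, ?_, hr.trans (le_weightedOrder_smul _),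
      by rw [map_smul, ← h, Submodule.coe_smul]⟩
    rw [RingHom.mem_ker] at *
    rw [map_smul, hf, smul_zero]

/-- The integer `φ_{r,1} = ℓ - ⌊(ε + 1) / 2⌋`, where `ℓ` and `ε` are the quotient and the remainder
of the division of `r` by `a`. The subtraction does not truncate when `r ∈ S`. -/
def phi1 (n r : ℕ) : ℕ := r / a n - (r % a n + 1) / 2

/-- `k` is `r`-good: `r + k q ≠ s + j q` for all `s ∈ S` with `s > r` and all `0 ≤ j ≤ φ_{s,1}`. -/
def IsGood (n r k : ℕ) : Prop :=
  ∀ s ∈ S n, r < s → ∀ j ≤ phi1 n s, r + k * q n ≠ s + j * q n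

/-- `H_r = [0, φ_{r,1}]`. -/
def H (n r : ℕ) : Finset ℕ := Finset.Icc 0 (phi1 n r)

open Classical in
/-- The set `G_r` of the `r`-good integers in `[0, φ_{r,1}]`. -/
def G (n r : ℕ) : Finset ℕ := (H n r).filter (IsGood n r)

/-- The span `T_r^L` of the monomials `t^(r + k q)`, `k ∈ L`; `T_r` is `T_r^L` for `L = H_r`. -/
def T (n r : ℕ) (L : Finset ℕ) : Submodule K (PowerSeries K) :=
  Submodule.span K ((fun k : ℕ => (PowerSeries.X ^ (r + k * q n) : PowerSeries K)) '' L)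

variable {K} in
theorem rho_monomial {n : ℕ} (hn : 3 ≤ n) (d : Fin 3 →₀ ℕ) (c : K) :
    rho K hn (monomial d c) = c • (PowerSeries.X ^ Finsupp.weight (wt n) d *
      (1 + PowerSeries.X ^ q n) ^ d 0) := by
  rw [rho, substAlgHom_monomial, Finsupp.prod_fintype _ _ (by simp), Finsupp.weight_apply,
    Finsupp.sum_fintype _ _ (by simp)]
  simp only [Fin.prod_univ_three, Fin.sum_univ_three, rhoImage, wt, Matrix.cons_val, smul_eq_mul]
  rw [← Algebra.smul_def]
  congr 1
  change (PowerSeries.X ^ a n * (1 + PowerSeries.X ^ q n)) ^ d 0 *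
    (PowerSeries.X ^ (a n + 1)) ^ d 1 * (PowerSeries.X ^ (a n + 2)) ^ d 2 = _
  rw [mul_pow]
  ring

theorem le_phi1 {n : ℕ} (hn : 3 ≤ n) (d : Fin 3 →₀ ℕ) : d 0 ≤ phi1 n (Finsupp.weight (wt n) d) := by
  have ha := a_pos hn
  rw [Finsupp.weight_apply, Finsupp.sum_fintype _ _ (by simp)]
  simp only [Fin.sum_univ_three, wt, Matrix.cons_val, smul_eq_mul, phi1]
  have e : d 0 * a n + d 1 * (a n + 1) + d 2 * (a n + 2) =
      (d 1 + 2 * d 2) + a n * (d 0 + d 1 + d 2) := by ring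
  rw [e, Nat.add_mul_div_left _ _ ha, Nat.add_mul_mod_self_left]
  have := Nat.mod_le (d 1 + 2 * d 2) (a n)
  clear e
  generalize (d 1 + 2 * d 2) / a n = u at *
  generalize (d 1 + 2 * d 2) % a n = v at *
  omega

variable {K} in
theorem rho_mem_T {n : ℕ} (hn : 3 ≤ n) (r : ℕ) (g : MvPowerSeries (Fin 3) K)
    (hg : g ∈ W K hn r) : rho K hn g ∈ T K n r (H n r) := by
  classical
  rw [mem_W_iff] at hg
  have hfin : {d : Fin 3 →₀ ℕ | Finsupp.weight (wt n) d ≤ r}.Finite :=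
    Finsupp.finite_of_nat_weight_le (wt n) (fun i => (wt_pos hn i).ne') r
  have hsum : g = ∑ d ∈ hfin.toFinset, monomial d (coeff d g) := by
    ext e
    simp only [map_sum, coeff_monomial]
    rw [Finset.sum_ite_eq]
    split_ifs with h
    · rfl
    · by_contra hc
      exact h (by simpa using (hg hc).le)
  rw [hsum, map_sum]
  refine Submodule.sum_mem _ fun d _ => ?_
  by_cases hd : coeff d g = 0
  · simp [hd]
  · have hw := hg hd
    have hle := le_phi1 hn d
    rw [hw] at hle
    rw [rho_monomial, hw, add_comm, add_pow, Finset.mul_sum]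
    refine Submodule.smul_mem _ _ (Submodule.sum_mem _ fun k hk => ?_)
    have hk' : k ≤ d 0 := Nat.lt_succ_iff.1 (Finset.mem_range.1 hk)
    have : (PowerSeries.X ^ r * ((PowerSeries.X ^ q n) ^ k * 1 ^ (d 0 - k) *
        ((d 0).choose k : PowerSeries K)) : PowerSeries K) =
        ((d 0).choose k : K) • PowerSeries.X ^ (r + k * q n) := by
      rw [one_pow, mul_one, ← pow_mul, mul_comm (q n) k, ← mul_assoc, ← pow_add,
        mul_comm, ← nsmul_eq_mul, Nat.cast_smul_eq_nsmul]
    rw [this]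
    exact Submodule.smul_mem _ _ (Submodule.subset_span
      ⟨k, by simpa [H] using hk'.trans hle, rfl⟩)

/-- The restriction `ρ_r : W_r → T_r` of `ρ`. -/
def rhoRes {n : ℕ} (hn : 3 ≤ n) (r : ℕ) : W K hn r →ₗ[K] T K n r (H n r) :=
  (rho K hn).toLinearMap.restrict (rho_mem_T hn r)

/-- The projection of `K⟦t⟧` that keeps the terms in `t^(r + k q)` with `k ∈ L` and drops all
other terms. -/
def keep (n r : ℕ) (L : Finset ℕ) : PowerSeries K →ₗ[K] PowerSeries K :=
  ∑ k ∈ L, (PowerSeries.coeff (R := K) (r + k * q n)).smulRight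
    (PowerSeries.X ^ (r + k * q n) : PowerSeries K)

variable {K} in
theorem keep_mem_T (n r : ℕ) (L : Finset ℕ) (f : PowerSeries K) :
    keep K n r L f ∈ T K n r L := by
  rw [keep, LinearMap.sum_apply]
  exact Submodule.sum_mem _ fun k hk =>
    Submodule.smul_mem _ _ (Submodule.subset_span ⟨k, hk, rfl⟩)

/-- For `L ⊆ H_r`, the natural projection `T_r → T_r^L`. -/
def proj (n r : ℕ) (L : Finset ℕ) : T K n r (H n r) →ₗ[K] T K n r L :=
  (keep K n r L).restrict fun f _ => keep_mem_T n r L f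

/-- The map `ρ_r^L : W_r → T_r^L`, the composition of `ρ_r` with the projection. -/
def rhoProj {n : ℕ} (hn : 3 ≤ n) (r : ℕ) (L : Finset ℕ) : W K hn r →ₗ[K] T K n r L :=
  proj K n r L ∘ₗ rhoRes K hn r

end MohPrimes

end

/-! Write `r = aℓ + ε`. Below `s0` no carry occurs, so every monomial of weight `r` has degree `ℓ`
and satisfies `d 1 + 2 * d 2 = ε`; its `x`-exponent is then `ℓ - ε + d 2` and determines it. Hence
`ρ(g) = t^r P(t^q)` for `g ∈ W_r`, where `P` is a combination of powers `(1 + X) ^ d 0`, divisible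
by `(1 + X) ^ (ℓ - ε)` (truncated subtraction).

If `g` lies in the kernel of the projection to the good exponents, `P` is supported on the non-good
ones. There are at most `ℓ - ε` of these (`card_not_isGood_le`), whereas in characteristic zero a
nonzero multiple of `(1 + X) ^ m` has more than `m` terms. So `P = 0`, and `g = 0` by independence
of the powers of `1 + X` (`ker_rhoProj_eq_bot`).

Terms of weight above `r` never reach a good exponent, so leading forms of elements of `ker ρ` lie
in this kernel (`V_le_ker_rhoProj`). The bound on the `σ`-order follows. -/

/-- Induction on `m`: for `k` in the support, the operator `X · d/dX - k` removes the term of degree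
`k`, creates no new one, and costs at most one factor `1 + X`. -/
theorem Polynomial.lt_card_support_of_X_add_one_pow_dvd {K : Type*} [Field K] [CharZero K] (m : ℕ)
    {f : Polynomial K} (hf : f ≠ 0) (h : (1 + Polynomial.X) ^ m ∣ f) : m < f.support.card := by
  induction m generalizing f with
  | zero => exact Finset.card_pos.2 (Polynomial.support_nonempty.2 hf)
  | succ m ih =>
    obtain ⟨k, hk⟩ := Polynomial.support_nonempty.2 hf
    have hcoeff (i : ℕ) : (Polynomial.X * Polynomial.derivative f -
        Polynomial.C (k : K) * f).coeff i = ((i : K) - k) * f.coeff i := by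
      rw [Polynomial.coeff_sub, Polynomial.coeff_C_mul]
      cases i with
      | zero => simp
      | succ i =>
        rw [Polynomial.coeff_X_mul, Polynomial.coeff_derivative]
        push_cast
        ring
    -- In characteristic zero the operator kills only multiples of `X ^ k`, which do not vanish at
    -- `-1`.
    have hne : Polynomial.X * Polynomial.derivative f - Polynomial.C (k : K) * f ≠ 0 := by
      intro h0
      have hmon : f = Polynomial.monomial k (f.coeff k) := by
        ext i
        rw [Polynomial.coeff_monomial]
        split_ifs with hi
        · rw [hi]
        · have := hcoeff i
          rw [h0, Polynomial.coeff_zero, eq_comm, mul_eq_zero, sub_eq_zero, Nat.cast_inj] at this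
          exact this.resolve_left fun h => hi h.symm
      obtain ⟨g, hg⟩ := (dvd_pow_self (1 + Polynomial.X : Polynomial K) m.succ_ne_zero).trans h
      have hev := congrArg (Polynomial.eval (-1)) hg
      rw [hmon] at hev
      simp at hev
      exact Polynomial.mem_support_iff.1 hk hev
    have hdvd : (1 + Polynomial.X) ^ m ∣
        Polynomial.X * Polynomial.derivative f - Polynomial.C (k : K) * f := by
      refine dvd_sub (Dvd.dvd.mul_left ?_ _) (Dvd.dvd.mul_left ((pow_dvd_pow _ m.le_succ).trans h) _)
      obtain ⟨g, rfl⟩ := h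
      rw [Polynomial.derivative_mul, Polynomial.derivative_pow]
      refine dvd_add ?_ (Dvd.dvd.mul_right (pow_dvd_pow _ m.le_succ) _)
      exact Dvd.dvd.mul_right (Dvd.dvd.mul_right (Dvd.dvd.mul_left (by simp) _) _) _
    have hsub : (Polynomial.X * Polynomial.derivative f - Polynomial.C (k : K) * f).support ⊆
        f.support.erase k := by
      intro i hi
      rw [Polynomial.mem_support_iff, hcoeff] at hi
      rw [Finset.mem_erase, Polynomial.mem_support_iff]
      refine ⟨?_, right_ne_zero_of_mul hi⟩
      rintro rfl
      simp at hi
    have h1 := Finset.card_le_card hsub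
    rw [Finset.card_erase_of_mem hk] at h1
    have := ih hne hdvd
    omega

namespace MohPrimes

/-! ### Arithmetic of `a`, `q`, `S` and `s0` -/

theorem a_eq (n : ℕ) : a n = n / 2 * q n := by
  unfold a q
  rcases Nat.even_or_odd' n with ⟨p, rfl | rfl⟩
  · rw [show (2 * p + 1) / 2 = p by omega, show 2 * p / 2 = p by omega]
    exact Nat.div_eq_of_eq_mul_left two_pos (by ring)
  · rw [show (2 * p + 1 + 1) / 2 = p + 1 by omega, show (2 * p + 1) / 2 = p by omega,
      show 2 * (p + 1) - 1 = 2 * p + 1 by omega, show 2 * p + 1 - 1 = 2 * p by omega]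
    exact Nat.div_eq_of_eq_mul_left two_pos (by ring)

theorem two_mul_lt_a {n : ℕ} (hn : 3 ≤ n) : 2 * (n - 2) < a n := by
  obtain ⟨m, rfl⟩ := Nat.exists_eq_add_of_le' hn
  have h : (m + 2) * (m + 3) / 2 = a (m + 3) := rfl
  rw [← h, Nat.lt_div_iff_mul_lt two_pos]
  rw [show m + 3 - 2 = m + 1 by omega]
  have : 2 * (m + 1) * 2 < (m + 2) * (m + 3) - (2 - 1) := by
    have : (m + 2) * (m + 3) = m * m + 5 * m + 6 := by ring
    have : m ≤ m * m + 1 := by nlinarith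
    omega
  omega

theorem exists_of_mem_S {n s : ℕ} (hs : s ∈ S n) : ∃ m e, s = a n * m + e ∧ e ≤ 2 * m := by
  induction hs using AddSubmonoid.closure_induction with
  | mem x hx =>
    rcases hx with rfl | rfl | rfl
    · exact ⟨1, 0, by simp, by simp⟩
    · exact ⟨1, 1, by simp, by simp⟩
    · exact ⟨1, 2, by simp, by simp⟩
  | zero => exact ⟨0, 0, by simp, by simp⟩
  | add x y _ _ hx hy =>
    obtain ⟨m, e, rfl, he⟩ := hx
    obtain ⟨m', e', rfl, he'⟩ := hy
    exact ⟨m + m', e + e', by ring, by omega⟩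

theorem mod_le_of_mem_S {n s : ℕ} (hn : 3 ≤ n) (hs : s ∈ S n) : s % a n ≤ 2 * (s / a n) := by
  obtain ⟨m, e, rfl, he⟩ := exists_of_mem_S hs
  rw [Nat.mul_add_mod, Nat.mul_add_div (a_pos hn)]
  exact (Nat.mod_le e (a n)).trans (he.trans (by rw [mul_add]; exact Nat.le_add_right _ _))

theorem weight_eq (n : ℕ) (d : Fin 3 →₀ ℕ) :
    Finsupp.weight (wt n) d = a n * (d 0 + d 1 + d 2) + (d 1 + 2 * d 2) := by
  rw [Finsupp.weight_apply, Finsupp.sum_fintype _ _ (by simp)]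
  simp only [Fin.sum_univ_three, wt, Matrix.cons_val, smul_eq_mul]
  ring

theorem weight_mem_S (n : ℕ) (d : Fin 3 →₀ ℕ) : Finsupp.weight (wt n) d ∈ S n := by
  rw [Finsupp.weight_apply, Finsupp.sum_fintype _ _ (by simp)]
  refine sum_mem fun i _ => nsmul_mem (AddSubmonoid.subset_closure ?_) _
  fin_cases i <;> simp [wt]

theorem div_lt_or_of_lt_s0 {n r : ℕ} (hn : 3 ≤ n) (hr : r < s0 n) :
    r / a n + 2 ≤ n ∨ r / a n + 1 = n ∧ r % a n ≤ 1 := by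
  have h1 := Nat.div_add_mod r (a n)
  have h3 := two_mul_lt_a hn
  unfold s0 at hr
  rcases lt_trichotomy (r / a n) (n - 1) with h | h | h
  · omega
  · rw [h] at h1
    omega
  · have : a n * (n - 1 + 1) ≤ a n * (r / a n) := Nat.mul_le_mul_left _ h
    rw [mul_add] at this
    omega

/-- A carry `d 1 + 2 * d 2 ≥ a > 2 (n - 2)` would force degree at least `n - 1`, hence weight at
least `a (n - 1) + a`, which is not below `s0`. -/
theorem degree_eq_div_and_eq_mod {n : ℕ} (hn : 3 ≤ n) {d : Fin 3 →₀ ℕ}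
    (hr : Finsupp.weight (wt n) d < s0 n) :
    d 0 + d 1 + d 2 = Finsupp.weight (wt n) d / a n ∧
      d 1 + 2 * d 2 = Finsupp.weight (wt n) d % a n := by
  have h := weight_eq n d
  have h3 := two_mul_lt_a hn
  have he : d 1 + 2 * d 2 < a n := by
    by_contra! hc
    have hm : n - 1 ≤ d 0 + d 1 + d 2 := by omega
    have := Nat.mul_le_mul_left (a n) hm
    unfold s0 at hr
    omega
  rw [h, Nat.mul_add_mod, Nat.mul_add_div (a_pos hn), Nat.mod_eq_of_lt he, Nat.div_eq_of_lt he]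
  simp

/-! ### Counting the non-good integers -/

/-- Non-good integers either come from the same residue block as `r` or from a later one. -/
theorem bounds_of_not_isGood {n r k : ℕ} (hn : 3 ≤ n) (hk : ¬ IsGood n r k) :
    1 ≤ k ∧ (r % a n + q n ≤ 2 * (r / a n) ∧
        k + (r % a n + q n + 1) / 2 ≤ r / a n + 1 ∨ a n ≤ r % a n + k * q n) := by
  simp only [IsGood, not_forall, not_not] at hk
  obtain ⟨s, hs, hrs, j, hj, h⟩ := hk
  have hq : 3 ≤ q n := by unfold q; omega
  have hjk : j < k := by
    by_contra! hc
    have := Nat.mul_le_mul_right (q n) hc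
    omega
  obtain ⟨i, rfl⟩ := Nat.exists_eq_add_of_lt hjk
  refine ⟨by omega, ?_⟩
  have hs' : s = r + (i + 1) * q n := by
    have : (j + i + 1) * q n = (i + 1) * q n + j * q n := by ring
    omega
  by_cases hlt : r % a n + (i + 1) * q n < a n
  · left
    have hdm := Nat.div_add_mod r (a n)
    have hs2 : s = a n * (r / a n) + (r % a n + (i + 1) * q n) := by omega
    have hdiv : s / a n = r / a n := by
      rw [hs2, Nat.mul_add_div (a_pos hn), Nat.div_eq_of_lt hlt, add_zero]
    have hmod : s % a n = r % a n + (i + 1) * q n := by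
      rw [hs2, Nat.mul_add_mod, Nat.mod_eq_of_lt hlt]
    -- Membership in `S` ensures that the subtraction in `phi1 n s` does not truncate.
    have hle := mod_le_of_mem_S hn hs
    rw [phi1, hdiv, hmod] at hj
    rw [hdiv, hmod] at hle
    -- Each further step of `q` raises `k - j` by one but lowers the bound on `j` by at least one,
    -- so `i = 0` is the extreme case.
    have h2 : 2 * i ≤ i * q n := by nlinarith
    rw [add_mul, one_mul] at *
    omega
  · right
    have : (i + 1) * q n ≤ (j + i + 1) * q n := Nat.mul_le_mul_right _ (by omega)
    omega

open Classical in
theorem card_not_isGood_le {n r : ℕ} (hn : 3 ≤ n) (hrS : r ∈ S n) (hr : r < s0 n) :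
    ((H n r).filter fun k => ¬ IsGood n r k).card ≤ r / a n - r % a n := by
  have hle := mod_le_of_mem_S hn hrS
  have hl := div_lt_or_of_lt_s0 hn hr
  have hb {k : ℕ} (hk : k ∈ (H n r).filter fun k => ¬ IsGood n r k) :
      k + (r % a n + 1) / 2 ≤ r / a n ∧ 1 ≤ k ∧
      (r % a n + q n ≤ 2 * (r / a n) ∧ k + (r % a n + q n + 1) / 2 ≤ r / a n + 1 ∨
        n / 2 ≤ k ∧ r % a n < q n ∨ n / 2 ≤ k + 1 ∧ q n ≤ r % a n) := by
    rw [Finset.mem_filter, H, Finset.mem_Icc, phi1] at hk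
    obtain ⟨h1, h2⟩ := bounds_of_not_isGood hn hk.2
    refine ⟨by omega, h1, h2.imp_right fun h => ?_⟩
    -- Since `a = ⌊n/2⌋ q` and `ε < 2q`, leaving the block takes at least `⌊n/2⌋` steps of `q` if `ε
    -- < q`, and at least one fewer otherwise.
    rcases lt_or_ge (r % a n) (q n) with hq | hq
    · refine Or.inl ⟨?_, hq⟩
      by_contra! hc
      have := Nat.mul_le_mul_right (q n) (Nat.succ_le_of_lt hc)
      rw [Nat.succ_mul, ← a_eq] at this
      omega
    · refine Or.inr ⟨?_, hq⟩
      by_contra! hc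
      have := Nat.mul_le_mul_right (q n) (Nat.succ_le_of_lt hc)
      rw [Nat.succ_mul, add_mul, one_mul, ← a_eq] at this
      have : q n = 2 * ((n + 1) / 2) - 1 := rfl
      omega
  have hq : q n = 2 * ((n + 1) / 2) - 1 := rfl
  generalize r / a n = l at *
  generalize r % a n = e at *
  generalize q n = q at *
  -- For `ℓ ≤ ε` the truncated bound is `0`, so all alternatives in `hb` must be contradictory.
  rcases le_or_gt l e with hel | hel
  · rw [Nat.sub_eq_zero_of_le hel, Nat.le_zero, Finset.card_eq_zero,
      Finset.eq_empty_iff_forall_notMem]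
    intro k hk
    have := hb hk
    omega
  rcases hl with hl | hl
  -- When both intervals are nonempty, their lengths add up to `2ℓ + 2 - n - ε`, as `⌊(n+1)/2⌋ +
  -- ⌊n/2⌋ = n`; this is at most `ℓ - ε` because `ℓ ≤ n - 2`.
  · by_cases hc : e + q ≤ 2 * l
    · refine (Finset.card_le_card (t := Finset.Icc 1 (l + 1 - (e + q + 1) / 2) ∪
        Finset.Icc (n / 2) (l - (e + 1) / 2)) fun k hk => ?_).trans
        ((Finset.card_union_le _ _).trans ?_)
      · have := hb hk
        simp only [Finset.mem_union, Finset.mem_Icc]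
        omega
      · simp only [Nat.card_Icc]
        omega
    · refine (Finset.card_le_card (t := Finset.Icc (n / 2) (l - (e + 1) / 2)) fun k hk => ?_).trans ?_
      · have := hb hk
        simp only [Finset.mem_Icc]
        omega
      · simp only [Nat.card_Icc]
        omega
  -- Here `ε ≤ 1`, so `⌊(ε+1)/2⌋ = ε` and discarding `k = 0` alone suffices.
  · refine (Finset.card_le_card (t := Finset.Icc 1 (l - (e + 1) / 2)) fun k hk => ?_).trans ?_
    · have := hb hk
      simp only [Finset.mem_Icc]
      omega
    · simp only [Nat.card_Icc]
      omega

/-! ### Coefficients of `ρ` and the inclusion of `V_r` in the kernel -/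

variable {K : Type*} [Field K]

theorem coeff_keep (n r : ℕ) (hq : q n ≠ 0) (L : Finset ℕ) (f : PowerSeries K) {k : ℕ}
    (hk : k ∈ L) :
    PowerSeries.coeff (r + k * q n) (keep K n r L f) = PowerSeries.coeff (r + k * q n) f := by
  rw [keep, LinearMap.sum_apply, map_sum, Finset.sum_eq_single k]
  · simp
  · intro j _ hj
    simp [PowerSeries.coeff_X_pow, hj.symm, hq]
  · exact fun h => absurd hk h

theorem mem_ker_rhoProj_iff {n : ℕ} (hn : 3 ≤ n) (r : ℕ) (L : Finset ℕ) (g : W K hn r) :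
    g ∈ LinearMap.ker (rhoProj K hn r L) ↔
      ∀ k ∈ L, PowerSeries.coeff (r + k * q n) (rho K hn g) = 0 := by
  have hq : q n ≠ 0 := by unfold q; omega
  have h : (rhoProj K hn r L g : PowerSeries K) = keep K n r L (rho K hn g) := rfl
  rw [LinearMap.mem_ker, ← Submodule.coe_eq_zero, h]
  constructor
  · intro h0 k hk
    rw [← coeff_keep n r hq L _ hk, h0, map_zero]
  · intro h0
    rw [keep, LinearMap.sum_apply]
    refine Finset.sum_eq_zero fun k hk => ?_
    simp [h0 k hk]

theorem coeff_rho {n : ℕ} (hn : 3 ≤ n) (f : MvPowerSeries (Fin 3) K) (N : ℕ) :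
    PowerSeries.coeff N (rho K hn f) =
      ∑ᶠ d, PowerSeries.coeff N (rho K hn (MvPowerSeries.monomial d (MvPowerSeries.coeff d f))) := by
  rw [rho, MvPowerSeries.substAlgHom_apply]
  refine (MvPowerSeries.coeff_subst (hasSubst_rho K hn) f _).trans (finsum_congr fun d => ?_)
  rw [MvPowerSeries.substAlgHom_monomial, ← Algebra.smul_def]
  rfl

theorem coeff_X_pow_mul_one_add_X_pow (r q m N : ℕ) :
    PowerSeries.coeff N (PowerSeries.X ^ r * (1 + PowerSeries.X ^ q) ^ m : PowerSeries K) =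
      ∑ j ∈ Finset.range (m + 1), if N = r + j * q then (m.choose j : K) else 0 := by
  rw [add_comm, add_pow, Finset.mul_sum, map_sum]
  refine Finset.sum_congr rfl fun j _ => ?_
  rw [one_pow, mul_one, ← pow_mul, mul_comm q j, ← mul_assoc, ← pow_add, mul_comm, ← nsmul_eq_mul,
    map_nsmul, PowerSeries.coeff_X_pow]
  split_ifs <;> simp

/-- Terms of weight greater than `r` do not contribute to good coefficients. -/
theorem coeff_rho_eq_zero_of_isGood {n r k : ℕ} (hn : 3 ≤ n) (hk : IsGood n r k)
    {f : MvPowerSeries (Fin 3) K} (hf : (r : ℕ∞) < f.weightedOrder (wt n)) :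
    PowerSeries.coeff (r + k * q n) (rho K hn f) = 0 := by
  rw [coeff_rho]
  refine finsum_eq_zero_of_forall_eq_zero fun d => ?_
  rw [rho_monomial, map_smul, coeff_X_pow_mul_one_add_X_pow]
  by_cases hd : Finsupp.weight (wt n) d ≤ r
  · rw [MvPowerSeries.coeff_eq_zero_of_lt_weightedOrder (wt n)
      (lt_of_le_of_lt (by exact_mod_cast hd) hf), zero_smul]
  · rw [Finset.sum_eq_zero, smul_zero]
    intro j hj
    rw [if_neg]
    exact hk _ (weight_mem_S n d) (not_le.1 hd) j
      ((Nat.lt_succ_iff.1 (Finset.mem_range.1 hj)).trans (le_phi1 hn d))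

theorem V_le_ker_rhoProj {n : ℕ} (hn : 3 ≤ n) (r : ℕ) :
    V K hn r ≤ LinearMap.ker (rhoProj K hn r (G n r)) := by
  classical
  intro g hg
  obtain ⟨f, hf, hr, hgf⟩ := (isLeadingForm_iff hn r g).1 hg
  rw [mem_ker_rhoProj_iff]
  intro k hk
  have hfg : (r : ℕ∞) < (f - g).weightedOrder (wt n) := by
    refine lt_of_lt_of_le (b := ((r + 1 : ℕ) : ℕ∞)) (by exact_mod_cast r.lt_succ_self)
      (MvPowerSeries.nat_le_weightedOrder (wt n) fun d hd => ?_)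
    rw [map_sub, hgf, MvPowerSeries.coeff_weightedHomogeneousComponent]
    split_ifs with h
    · rw [sub_self]
    · rw [sub_zero]
      exact MvPowerSeries.coeff_eq_zero_of_lt_weightedOrder (wt n)
        (lt_of_lt_of_le (by exact_mod_cast (by omega : Finsupp.weight (wt n) d < r)) hr)
  have := coeff_rho_eq_zero_of_isGood hn (Finset.mem_filter.1 hk).2 hfg
  rw [map_sub, (RingHom.mem_ker).1 hf, zero_sub, map_neg, neg_eq_zero] at this
  exact this

/-! ### Vanishing of the kernel below `s0` -/

theorem ker_rhoProj_eq_bot [CharZero K] {n r : ℕ} (hn : 3 ≤ n) (hrS : r ∈ S n) (hr : r < s0 n) :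
    LinearMap.ker (rhoProj K hn r (G n r)) = ⊥ := by
  classical
  rw [Submodule.eq_bot_iff]
  intro g hg
  rw [mem_ker_rhoProj_iff] at hg
  have hw : g.1.IsWeightedHomogeneous (wt n) r := (mem_W_iff hn r g.1).1 g.2
  have hq : q n ≠ 0 := by unfold q; omega
  have hfin : {d : Fin 3 →₀ ℕ | Finsupp.weight (wt n) d ≤ r}.Finite :=
    Finsupp.finite_of_nat_weight_le (wt n) (fun i => (wt_pos hn i).ne') r
  set D := hfin.toFinset.filter fun d => Finsupp.weight (wt n) d = r with hD
  have hmem {d} : d ∈ D ↔ Finsupp.weight (wt n) d = r := by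
    simp only [hD, Finset.mem_filter, Set.Finite.mem_toFinset]
    exact ⟨fun h => h.2, fun h => ⟨h.le, h⟩⟩
  have hdiv {d} (hd : d ∈ D) : d 0 + d 1 + d 2 = r / a n ∧ d 1 + 2 * d 2 = r % a n := by
    rw [hmem] at hd
    have := degree_eq_div_and_eq_mod hn (d := d) (by rw [hd]; exact hr)
    rwa [hd] at this
  set P : Polynomial K := ∑ d ∈ D, Polynomial.C (MvPowerSeries.coeff d g.1) *
    (1 + Polynomial.X) ^ d 0 with hP
  have hPcoeff (k : ℕ) : PowerSeries.coeff (r + k * q n) (rho K hn g) = P.coeff k := by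
    rw [coeff_rho, finsum_eq_sum_of_support_subset (s := D), hP, Polynomial.finsetSum_coeff]
    · refine Finset.sum_congr rfl fun d hd => ?_
      rw [rho_monomial, map_smul, hmem.1 hd, coeff_X_pow_mul_one_add_X_pow, Polynomial.coeff_C_mul,
        Polynomial.coeff_one_add_X_pow, smul_eq_mul]
      simp only [add_right_inj, Nat.mul_left_inj hq, Finset.sum_ite_eq, Finset.mem_range]
      split_ifs with h
      · rfl
      · rw [Nat.choose_eq_zero_of_lt (by omega), Nat.cast_zero]
    · intro d hd
      rw [Finset.mem_coe, hmem]
      refine hw fun h0 => hd ?_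
      simp [h0]
  have hdvd : (1 + Polynomial.X) ^ (r / a n - r % a n) ∣ P := by
    refine Finset.dvd_sum fun d hd => Dvd.dvd.mul_left (pow_dvd_pow _ ?_) _
    have := hdiv hd
    omega
  have hP0 : P = 0 := by
    by_contra hne
    have h1 := Polynomial.lt_card_support_of_X_add_one_pow_dvd _ hne hdvd
    refine absurd (h1.trans_le (Finset.card_le_card fun k hk => ?_))
      (card_not_isGood_le hn hrS hr).not_gt
    rw [Polynomial.mem_support_iff] at hk
    have hkH : k ∈ H n r := by
      by_contra hkH
      apply hk
      rw [hP, Polynomial.finsetSum_coeff]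
      refine Finset.sum_eq_zero fun d hd => ?_
      have hle := le_phi1 hn d
      rw [hmem.1 hd] at hle
      rw [H, Finset.mem_Icc] at hkH
      rw [Polynomial.coeff_C_mul, Polynomial.coeff_one_add_X_pow,
        Nat.choose_eq_zero_of_lt (by omega), Nat.cast_zero, mul_zero]
    rw [Finset.mem_filter]
    refine ⟨hkH, fun hgood => hk ?_⟩
    rw [← hPcoeff]
    exact hg k (Finset.mem_filter.2 ⟨hkH, hgood⟩)
  -- Substituting `X - 1` turns the powers of `1 + X` into monomials, whose exponents `d 0` are
  -- distinct on `D`.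
  have hcomp : ∑ d ∈ D, Polynomial.C (MvPowerSeries.coeff d g.1) * Polynomial.X ^ d 0 = 0 := by
    have := congrArg (fun p => p.comp (Polynomial.X - 1)) hP0
    simpa [hP] using this
  ext e
  rw [ZeroMemClass.coe_zero, map_zero]
  by_contra hne
  have he : e ∈ D := hmem.2 (hw hne)
  apply hne
  have := congrArg (Polynomial.coeff · (e 0)) hcomp
  simp only [Polynomial.finsetSum_coeff, Polynomial.coeff_C_mul, Polynomial.coeff_X_pow,
    Polynomial.coeff_zero] at this
  rw [Finset.sum_eq_single e] at this
  · simpa using this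
  · intro d hd hde
    rw [if_neg, mul_zero]
    intro h0
    refine hde (Finsupp.ext fun i => ?_)
    have h1 := hdiv hd
    have h2 := hdiv he
    fin_cases i <;> simp <;> omega
  · exact fun h => absurd he h

/-! ### Nonzero elements of `ker ρ` and their `σ`-order -/

theorem X_pow_sub_X_pow_mem_ker_rho {n : ℕ} (hn : 3 ≤ n) :
    (MvPowerSeries.X 1 ^ (a n + 2) - MvPowerSeries.X 2 ^ (a n + 1) : MvPowerSeries (Fin 3) K) ∈
      RingHom.ker (rho K hn) := by
  rw [RingHom.mem_ker, map_sub, map_pow, map_pow, rho, MvPowerSeries.substAlgHom_X,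
    MvPowerSeries.substAlgHom_X, sub_eq_zero]
  change (PowerSeries.X ^ (a n + 1)) ^ (a n + 2) =
    ((PowerSeries.X ^ (a n + 2)) ^ (a n + 1) : PowerSeries K)
  rw [← pow_mul, ← pow_mul, mul_comm]

theorem X_pow_sub_X_pow_ne_zero (n : ℕ) :
    (MvPowerSeries.X 1 ^ (a n + 2) - MvPowerSeries.X 2 ^ (a n + 1) :
      MvPowerSeries (Fin 3) K) ≠ 0 := by
  classical
  intro h
  have := congrArg (MvPowerSeries.coeff (Finsupp.single 1 (a n + 2))) h
  rw [map_sub, MvPowerSeries.coeff_X_pow, MvPowerSeries.coeff_X_pow, if_pos rfl, if_neg] at this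
  · simp at this
  · intro h
    simpa using DFunLike.congr_fun h 1

theorem le_sigmaOrder_of_mem_ker_rho [CharZero K] {n : ℕ} (hn : 3 ≤ n)
    {f : MvPowerSeries (Fin 3) K} (hf : f ∈ RingHom.ker (rho K hn)) (hf0 : f ≠ 0) :
    (s0 n : ℕ∞) ≤ sigmaOrder hn f := by
  classical
  rw [sigmaOrder_eq_weightedOrder]
  by_contra! hlt
  have hfin := (MvPowerSeries.ne_zero_iff_weightedOrder_finite (wt n)).1 hf0
  obtain ⟨⟨d, hd, hdw⟩, -⟩ := (MvPowerSeries.weightedOrder_eq_nat _).1 hfin.symm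
  rw [← hfin] at hlt
  have hr : (f.weightedOrder (wt n)).toNat < s0 n := by exact_mod_cast hlt
  set r := (f.weightedOrder (wt n)).toNat
  have hrS : r ∈ S n := hdw ▸ weight_mem_S n d
  let g : W K hn r := ⟨MvPowerSeries.weightedHomogeneousComponent (wt n) r f,
    (mem_W_iff hn r _).2 (MvPowerSeries.isWeightedHomogeneous_weightedHomogeneousComponent _ _ _)⟩
  have hg : g ∈ V K hn r := (isLeadingForm_iff hn r g).2 ⟨f, hf, hfin.le, rfl⟩
  have hg0 : g = 0 := by
    have := V_le_ker_rhoProj hn r hg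
    rwa [ker_rhoProj_eq_bot hn hrS hr, Submodule.mem_bot] at this
  have := congrArg (fun g : W K hn r => MvPowerSeries.coeff d g.1) hg0
  simp only [g, MvPowerSeries.coeff_weightedHomogeneousComponent, if_pos hdw] at this
  exact hd (by simpa using this)

end MohPrimes

theorem mainTheorem4 (K : Type*) [Field K] [CharZero K] (n : ℕ) (hn : 3 ≤ n) :
    (∀ r ∈ MohPrimes.S n, r ≠ 0 → r < MohPrimes.s0 n →
      MohPrimes.V K hn r = LinearMap.ker (MohPrimes.rhoProj K hn r (MohPrimes.G n r)) ∧
      LinearMap.ker (MohPrimes.rhoProj K hn r (MohPrimes.G n r)) = ⊥) ∧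
    ∃ m : ℕ, IsLeast (MohPrimes.sigmaOrder hn ''
        {f : MvPowerSeries (Fin 3) K | f ∈ RingHom.ker (MohPrimes.rho K hn) ∧ f ≠ 0}) (m : ℕ∞) ∧
      MohPrimes.s0 n ≤ m := by
  refine ⟨fun r hrS _ hr => ?_, ?_⟩
  · have h := MohPrimes.ker_rhoProj_eq_bot (K := K) hn hrS hr
    refine ⟨le_antisymm (MohPrimes.V_le_ker_rhoProj hn r) ?_, h⟩
    rw [h]
    exact bot_le
  · have hne : (MohPrimes.sigmaOrder hn ''
        {f : MvPowerSeries (Fin 3) K | f ∈ RingHom.ker (MohPrimes.rho K hn) ∧ f ≠ 0}).Nonempty :=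
      ⟨_, _, ⟨MohPrimes.X_pow_sub_X_pow_mem_ker_rho hn, MohPrimes.X_pow_sub_X_pow_ne_zero n⟩, rfl⟩
    have hmem := csInf_mem hne
    obtain ⟨f, hf, h⟩ := hmem
    have hfin := (MvPowerSeries.ne_zero_iff_weightedOrder_finite (MohPrimes.wt n)).1 hf.2
    rw [← MohPrimes.sigmaOrder_eq_weightedOrder hn] at hfin
    refine ⟨(MohPrimes.sigmaOrder hn f).toNat, ?_, ?_⟩
    · rw [hfin]
      refine ⟨⟨f, hf, rfl⟩, fun x hx => ?_⟩
      rw [h]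
      exact csInf_le' hx
    · have := MohPrimes.le_sigmaOrder_of_mem_ker_rho hn hf.1 hf.2
      rw [← hfin] at this
      exact_mod_cast this
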